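/- Let $J=J(\{a_j\},\{b_j\},\{c_j\})_{j\in\mathbb Z}$ be a whole-line Jacobi matrix with uniformly bounded complex entries and $a_nc_n\neq 0$ for all $n$, acting on $\ell^2(\mathbb Z)$ by $(Ju)_k=a_{k-1}u_{k-1}+b_ku_k+c_ku_{k+1}$, and let $J_0=J(\{1\},\{0\},\{1\})$. Assume that $J-J_0$ is of trace class, that is, $\sum_{n\in\mathbb Z}(|1-a_n|+|b_n|+|1-c_n|)<\infty$, and put $$\Delta:=\sum_{n\in\mathbb Z}\bigl(|b_n|+|1-a_nc_n|\bigr),\qquad \omega(z):=\frac{2z}{1-z^2}.$$ For $0<|z|<1$ let $L(z,J):=\det\bigl(I+(J-J_0)(J_0-\lambda(z))^{-1}\bigr)$ with $\lambda(z)=z+1/z$ be the perturbation determinant (a Fredholm determinant), and let $L(0,J):=1$, its value at $\lambda=\infty$. Let $\sigma_d(J)$ be the discrete spectrum of $J$, i.e. the set of isolated points of the spectrum that are eigenvalues of finite algebraic multiplicity. The equation $(4x+5x^2)e^{4x}=1$ has a unique positive root $\kappa$, and $\kappa\approx 0.129$ (to three decimal places). For every such $J$: (i) $L(z,J)\neq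 0$ for every $z$ with $|z|<1$ and $|\omega(z)|\,(\Delta^{1/2}+\Delta)<\kappa$; (ii) the discrete spectrum lies in a Cassini oval: $$\sigma_d(J)\subset\left\{\lambda\in\mathbb C\setminus[-2,2]:\ |\lambda^2-4|\le\left(\frac{2(\Delta^{1/2}+\Delta)}{\kappa}\right)^2\right\}.$$ -/

import Mathlib

open scoped ENNReal Topology

noncomputable section

namespace JacobiEnclosure

/-- The complex Hilbert space `ℓ²(ℤ)`. -/
abbrev L2Z : Type := lp (fun _ : ℤ => ℂ) 2

/-! ### Multiplication and translation operators on `ℓ²(ℤ)` -/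

lemma memℓp_comp (e : ℤ ≃ ℤ) (u : L2Z) : Memℓp (fun k => u (e k)) 2 := by
  have h := lp.memℓp u
  rw [memℓp_gen_iff (by norm_num)] at h ⊢
  exact (e.summable_iff (f := fun k => ‖u k‖ ^ (2 : ℝ≥0∞).toReal)).2 h

/-- Multiplication by a bounded sequence, `(diag w u)_k = w_k u_k`. -/
def diag (w : ℤ → ℂ) (hw : ∃ M : ℝ, ∀ k, ‖w k‖ ≤ M) : L2Z →L[ℂ] L2Z :=
  lp.mapCLM 2 (fun k => ContinuousLinearMap.mul ℂ ℂ (w k)) (K := hw.choose)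
    ((norm_nonneg _).trans (hw.choose_spec 0))
    (fun k => (ContinuousLinearMap.opNorm_mul_apply_le ℂ ℂ (w k)).trans (hw.choose_spec k))

/-- Translation, `(shift d u)_k = u_{k+d}`. -/
def shift (d : ℤ) : L2Z →L[ℂ] L2Z :=
  LinearMap.mkContinuousOfExistsBound
    { toFun := fun u => ⟨fun k => u (k + d), memℓp_comp (Equiv.addRight d) u⟩
      map_add' := fun _ _ => rfl
      map_smul' := fun _ _ => rfl }
    ⟨1, fun u => by
      rw [one_mul, lp.norm_eq_tsum_rpow (by norm_num), lp.norm_eq_tsum_rpow (by norm_num)]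
      refine le_of_eq (congrArg (· ^ (1 / (2 : ℝ≥0∞).toReal)) ?_)
      exact (Equiv.addRight d).tsum_eq (fun k => ‖u k‖ ^ (2 : ℝ≥0∞).toReal)⟩

/-! ### Whole-line Jacobi matrices -/

/-- A whole-line Jacobi matrix `J({a_j}, {b_j}, {c_j})`, `j ∈ ℤ`, with uniformly bounded complex
entries and `a_n c_n ≠ 0`. -/
structure JacobiMatrix where
  a : ℤ → ℂ
  b : ℤ → ℂ
  c : ℤ → ℂ
  bounded : ∃ M : ℝ, ∀ n, ‖a n‖ ≤ M ∧ ‖b n‖ ≤ M ∧ ‖c n‖ ≤ M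
  ne_zero : ∀ n, a n * c n ≠ 0

namespace JacobiMatrix

lemma bounded_a (J : JacobiMatrix) : ∃ M : ℝ, ∀ n, ‖J.a (n - 1)‖ ≤ M :=
  J.bounded.imp fun _ h n => (h (n - 1)).1

lemma bounded_b (J : JacobiMatrix) : ∃ M : ℝ, ∀ n, ‖J.b n‖ ≤ M :=
  J.bounded.imp fun _ h n => (h n).2.1

lemma bounded_c (J : JacobiMatrix) : ∃ M : ℝ, ∀ n, ‖J.c n‖ ≤ M :=
  J.bounded.imp fun _ h n => (h n).2.2

/-- The bounded operator of a Jacobi matrix on `ℓ²(ℤ)`; see `op_apply`. -/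
def op (J : JacobiMatrix) : L2Z →L[ℂ] L2Z :=
  diag (fun k => J.a (k - 1)) J.bounded_a ∘L shift (-1) + diag J.b J.bounded_b
    + diag J.c J.bounded_c ∘L shift 1

lemma op_apply (J : JacobiMatrix) (u : L2Z) (k : ℤ) :
    J.op u k = J.a (k - 1) * u (k - 1) + J.b k * u k + J.c k * u (k + 1) := rfl

/-- The discrete Laplacian `J₀ = J({1}, {0}, {1})`. -/
def free : JacobiMatrix where
  a := fun _ => 1
  b := fun _ => 0
  c := fun _ => 1
  bounded := ⟨1, fun _ => by simp⟩
  ne_zero := fun _ => by simp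

/-- `J - J₀` is of trace class: `∑ₙ (|1 - aₙ| + |bₙ| + |1 - cₙ|) < ∞`. -/
def IsTraceClassPerturbation (J : JacobiMatrix) : Prop :=
  Summable fun n : ℤ => ‖1 - J.a n‖ + ‖J.b n‖ + ‖1 - J.c n‖

/-- `Δ = ∑ₙ (|bₙ| + |1 - aₙ cₙ|)`. -/
def Delta (J : JacobiMatrix) : ℝ :=
  ∑' n : ℤ, (‖J.b n‖ + ‖1 - J.a n * J.c n‖)

/-- The discrete spectrum: the isolated points of the spectrum that are eigenvalues of finite
algebraic multiplicity (the dimension of the space of generalized eigenvectors). -/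
def discreteSpectrum (J : JacobiMatrix) : Set ℂ :=
  {μ | (∀ᶠ ν in 𝓝[≠] μ, ν ∉ spectrum ℂ J.op) ∧
    Module.End.HasEigenvalue (J.op : Module.End ℂ L2Z) μ ∧
    FiniteDimensional ℂ (Module.End.maxGenEigenspace (J.op : Module.End ℂ L2Z) μ)}

end JacobiMatrix

/-! ### The perturbation determinant -/

/-- The entry `⟨e_i, A e_j⟩` of an operator in the standard basis of `ℓ²(ℤ)`. -/
def entry (A : L2Z →L[ℂ] L2Z) (i j : ℤ) : ℂ :=
  A (lp.single 2 j (1 : ℂ)) i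

/-- The Fredholm determinant `det (I + A) = ∑ₖ tr (Λᵏ A)` of a trace class operator `A` on `ℓ²(ℤ)`.
The vectors `e_{i₁} ∧ ⋯ ∧ e_{iₖ}`, `i₁ < ⋯ < iₖ`, form an orthonormal basis of `Λᵏ ℓ²(ℤ)`, in which
the diagonal entries of `Λᵏ A` are the principal minors of order `k` of the matrix of `A`; so
`det (I + A)` is the (absolutely convergent) sum of the principal minors over all finite sets of
indices. -/
def fredholmDet (A : L2Z →L[ℂ] L2Z) : ℂ :=
  ∑' S : Finset ℤ, (Matrix.of fun i j : S => entry A i j).det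

/-- The Zhukovsky function `λ(z) = z + 1/z`. -/
def zhukovsky (z : ℂ) : ℂ := z + z⁻¹

/-- `(J₀ - λ(z))⁻¹` for `z` in the open unit disk; at `z = 0`, where `λ(z) = ∞`, the resolvent
vanishes. (`Ring.inverse` is the inverse in the algebra of bounded operators, and the operator is
invertible for `0 < |z| < 1`.) -/
def freeResolvent (z : ℂ) : L2Z →L[ℂ] L2Z :=
  if z = 0 then 0
  else Ring.inverse (JacobiMatrix.free.op - zhukovsky z • ContinuousLinearMap.id ℂ L2Z)

/-- The perturbation determinant `L(z, J) = det (I + (J - J₀) (J₀ - λ(z))⁻¹)`, `|z| < 1`. -/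
def perturbationDet (z : ℂ) (J : JacobiMatrix) : ℂ :=
  fredholmDet ((J.op - JacobiMatrix.free.op) ∘L freeResolvent z)

/-- `ω(z) = 2z / (1 - z²)`. -/
def omega (z : ℂ) : ℂ := 2 * z / (1 - z ^ 2)

end JacobiEnclosure

end

/-!
The proof is a Birman–Schwinger argument. Conjugation by a diagonal matrix (`gauge`) turns
`J(a, b, c)` into `J(1, b, a c)`, whose difference `V` from `J₀` has rows of `ℓ¹` norm
`|bₙ| + |1 - aₙ cₙ|`, with sum `Δ`. The Green function `z ^ |m - n| / (z - z⁻¹)` of `J₀` is bounded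
by `|ω(z)| / 2`. So the entries of `V G` are bounded row by row by numbers with sum
`q = Δ |ω(z)| / 2`, and the condition `|ω(z)| (√Δ + Δ) < κ` makes `q` less than `1 / 2`, because
`κ < 1`.

*The determinant.* The principal minors of order `k` of a matrix with such rows sum up to at most
`k! e_k ≤ q ^ k`, hence `|det (1 + V G) - 1| ≤ q / (1 - q) < 1`, uniformly in the size
(`norm_det_one_add_sub_one_le`). The perturbation determinant is the limit of determinants over
`{-N, …, N}` (`tendsto_det_one_add_truncatedKernel`). These are unchanged by the gauge
transformation: the compressed Green function is the inverse of the compressed `J₀ - λ(z)` up to a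
diagonal correction, so that they are, up to a common factor, determinants of tridiagonal matrices
(`det_one_add_truncatedKernel`).

*The discrete spectrum.* If `λ(z)` is an eigenvalue with eigenvector `u`, then the gauge transform
of `u` is a bounded sequence `x` with `x = -G V x`, and `‖G V x‖ ≤ q ‖x‖` in the supremum norm; so
`x = 0` (`eq_zero_of_op_eq_smul`). Plane waves show that `J - μ` is not bounded below for
`μ ∈ [-2, 2]`. Hence `[-2, 2]` lies in the spectrum and has no isolated point of it
(`notMem_image_Icc_of_mem_discreteSpectrum`). As `|ω(z)|² |λ(z)² - 4| = 4`, the two parts give the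
Cassini oval.
-/

open scoped ENNReal Topology

namespace JacobiEnclosure

/-! ### Principal minors of finite matrices -/

/-- A determinant is at most the product of the `ℓ¹` norms of the rows. -/
lemma norm_det_le_prod_sum {ι : Type*} [Fintype ι] [DecidableEq ι] (A : Matrix ι ι ℂ) :
    ‖A.det‖ ≤ ∏ i, ∑ j, ‖A i j‖ := by
  rw [← Matrix.det_transpose, Matrix.det_apply, Finset.prod_univ_sum]
  refine (norm_sum_le _ _).trans ?_
  calc ∑ σ : Equiv.Perm ι, ‖Equiv.Perm.sign σ • ∏ i, A.transpose (σ i) i‖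
      = ∑ σ : Equiv.Perm ι, ∏ i, ‖A i (σ i)‖ := by
        refine Finset.sum_congr rfl fun σ _ => ?_
        rcases Int.units_eq_one_or (Equiv.Perm.sign σ) with h | h <;> simp [h, norm_prod]
    _ = ∑ f ∈ Finset.univ.map ⟨fun (σ : Equiv.Perm ι) => (σ : ι → ι), DFunLike.coe_injective⟩,
          ∏ i, ‖A i (f i)‖ := by simp
    _ ≤ _ := Finset.sum_le_sum_of_subset_of_nonneg (fun f _ => by simp)
        fun f _ _ => Finset.prod_nonneg fun i _ => norm_nonneg _

lemma norm_det_le_factorial {ι : Type*} [Fintype ι] [DecidableEq ι] (A : Matrix ι ι ℂ)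
    (w : ι → ℝ) (h : ∀ i j, ‖A i j‖ ≤ w i) :
    ‖A.det‖ ≤ (Fintype.card ι).factorial * ∏ i, w i := by
  rw [← Matrix.det_transpose, Matrix.det_apply]
  refine (norm_sum_le _ _).trans ?_
  calc ∑ σ : Equiv.Perm ι, ‖Equiv.Perm.sign σ • ∏ i, A.transpose (σ i) i‖
      ≤ ∑ σ : Equiv.Perm ι, ∏ i, w i := by
        refine Finset.sum_le_sum fun σ _ => ?_
        have : ‖Equiv.Perm.sign σ • ∏ i, A.transpose (σ i) i‖ = ∏ i, ‖A i (σ i)‖ := by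
          rcases Int.units_eq_one_or (Equiv.Perm.sign σ) with h | h <;> simp [h, norm_prod]
        rw [this]
        exact Finset.prod_le_prod (fun _ _ => norm_nonneg _) fun i _ => h i _
    _ = _ := by simp [Finset.card_univ, Fintype.card_perm]

/-- `det (1 + B)` is the sum of all principal minors of `B`. -/
lemma det_one_add_eq_sum_principal_minors {α : Type*} [DecidableEq α] (Ω : Finset α)
    (B : α → α → ℂ) :
    (1 + Matrix.of fun i j : Ω => B i j).det =
      ∑ S ∈ Ω.powerset, (Matrix.of fun i j : S => B i j).det := by
  set M : Matrix Ω Ω ℂ := Matrix.of fun i j : Ω => B i j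
  have h1 : (1 + M).det = ∑ s : Finset Ω, (M.submatrix (↑) (↑) : Matrix s s ℂ).det := by
    rw [add_comm]
    change Matrix.detRowAlternating (M.row + (1 : Matrix Ω Ω ℂ).row) = _
    rw [AlternatingMap.map_add_univ]
    exact Finset.sum_congr rfl fun s _ => Matrix.det_piecewise_one_eq_submatrix_det M s
  rw [h1]
  refine Finset.sum_bij' (fun s _ => s.map (Function.Embedding.subtype _))
    (fun S _ => S.subtype (· ∈ Ω)) ?_ ?_ ?_ ?_ ?_
  · intro s _
    rw [Finset.mem_powerset]
    intro x hx
    obtain ⟨y, _, rfl⟩ := Finset.mem_map.1 hx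
    exact y.2
  · intro S _
    exact Finset.mem_univ _
  · intro s _
    ext x
    simp
  · intro S hS
    rw [Finset.subtype_map]
    exact Finset.filter_true_of_mem fun x hx => Finset.mem_powerset.1 hS hx
  · intro s _
    let e : s ≃ s.map (Function.Embedding.subtype (· ∈ Ω)) :=
      Equiv.ofBijective (fun x => ⟨x.1, Finset.mem_map_of_mem _ x.2⟩)
        ⟨fun x y h => Subtype.ext (Subtype.ext (Subtype.mk.inj h)), fun ⟨y, hy⟩ => by
          obtain ⟨x, hx, rfl⟩ := Finset.mem_map.1 hy
          exact ⟨⟨x, hx⟩, rfl⟩⟩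
    exact Matrix.det_submatrix_equiv_self e (Matrix.of fun i j : s.map _ => B i j)

/-- `k! e_k(w) ≤ (∑ w)^k` for the elementary symmetric functions of nonnegative numbers. -/
lemma factorial_mul_sum_powersetCard_prod_le {α : Type*} [DecidableEq α] (w : α → ℝ)
    (hw : ∀ i, 0 ≤ w i) (s : Finset α) (k : ℕ) :
    k.factorial * ∑ S ∈ s.powersetCard k, ∏ i ∈ S, w i ≤ (∑ i ∈ s, w i) ^ k := by
  induction s using Finset.induction_on generalizing k with
  | empty => 
    cases k with
    | zero => simp
    | succ k => rw [Finset.powersetCard_eq_empty.2 (by simp)]; simp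
  | insert a s ha ih =>
    cases k with
    | zero => simp
    | succ k =>
      rw [Finset.powersetCard_succ_insert ha, Finset.sum_union, Finset.sum_image,
        Finset.sum_insert ha]
      · have hX : 0 ≤ ∑ i ∈ s, w i := Finset.sum_nonneg fun i _ => hw i
        have h2 : ∑ S ∈ s.powersetCard k, ∏ i ∈ insert a S, w i
            = w a * ∑ S ∈ s.powersetCard k, ∏ i ∈ S, w i := by
          rw [Finset.mul_sum]
          refine Finset.sum_congr rfl fun S hS => Finset.prod_insert fun h => ha ?_
          exact (Finset.mem_powersetCard.1 hS).1 h
        rw [h2, mul_add]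
        have h3 := ih (k + 1)
        have h4 := mul_le_mul_of_nonneg_left (ih k)
          (mul_nonneg (Nat.cast_nonneg (k + 1)) (hw a))
        -- Bernoulli's inequality
        have h5 := pow_add_mul_le_add_pow hX
          (by linarith [hw a] : 0 ≤ 2 * (∑ i ∈ s, w i) + w a) (k + 1)
        rw [Nat.factorial_succ] at h3 ⊢
        rw [Nat.add_sub_cancel] at h5
        rw [add_comm (w a), Nat.succ_eq_add_one]
        push_cast at h3 h4 h5 ⊢
        linarith
      · intro S hS T hT h
        have hS' : a ∉ S := fun h => ha ((Finset.mem_powersetCard.1 (Finset.mem_coe.1 hS)).1 h)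
        have hT' : a ∉ T := fun h => ha ((Finset.mem_powersetCard.1 (Finset.mem_coe.1 hT)).1 h)
        rw [← Finset.erase_insert hS', ← Finset.erase_insert hT', h]
      · rw [Finset.disjoint_left]
        intro S hS hS'
        obtain ⟨T, _, rfl⟩ := Finset.mem_image.1 hS'
        exact ha ((Finset.mem_powersetCard.1 hS).1 (Finset.mem_insert_self a T))

/-- If the rows of `B` are bounded entrywise by `w i` and `∑ w ≤ x < 1`, then `det (1 + B)` differs
from `1` by at most `x / (1 - x)`, whatever the size of `B`: the principal minors of order `k` sum
up to at most `k! e_k(w) ≤ x ^ k`. -/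
lemma norm_det_one_add_sub_one_le {α : Type*} [DecidableEq α] (Ω : Finset α) (B : α → α → ℂ)
    (w : α → ℝ) (hB : ∀ i j, ‖B i j‖ ≤ w i) {x : ℝ} (hx : ∑ i ∈ Ω, w i ≤ x) (hx1 : x < 1) :
    ‖(1 + Matrix.of fun i j : Ω => B i j).det - 1‖ ≤ x / (1 - x) := by
  have hw : ∀ i, 0 ≤ w i := fun i => (norm_nonneg _).trans (hB i i)
  have hX : 0 ≤ ∑ i ∈ Ω, w i := Finset.sum_nonneg fun i _ => hw i
  have hx0 : 0 ≤ x := hX.trans hx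
  rw [det_one_add_eq_sum_principal_minors, Finset.sum_powerset, Finset.sum_range_succ']
  have h0 : ∑ S ∈ Finset.powersetCard 0 Ω, (Matrix.of fun i j : S => B i j).det = 1 := by
    simp
  rw [h0, add_sub_cancel_right]
  refine (norm_sum_le _ _).trans ?_
  have hk : ∀ k, ‖∑ S ∈ Finset.powersetCard (k + 1) Ω, (Matrix.of fun i j : S => B i j).det‖
      ≤ x * x ^ k := by
    intro k
    refine (norm_sum_le _ _).trans ?_
    calc ∑ S ∈ Finset.powersetCard (k + 1) Ω, ‖(Matrix.of fun i j : S => B i j).det‖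
        ≤ ∑ S ∈ Finset.powersetCard (k + 1) Ω, ((k + 1).factorial : ℝ) * ∏ i ∈ S, w i := by
          refine Finset.sum_le_sum fun S hS => ?_
          have := norm_det_le_factorial (Matrix.of fun i j : S => B i j) (fun i => w i)
            fun i j => hB i j
          rwa [Fintype.card_coe, (Finset.mem_powersetCard.1 hS).2,
            Finset.prod_coe_sort S w] at this
      _ = (k + 1).factorial * ∑ S ∈ Finset.powersetCard (k + 1) Ω, ∏ i ∈ S, w i := by
          rw [Finset.mul_sum]
      _ ≤ (∑ i ∈ Ω, w i) ^ (k + 1) := factorial_mul_sum_powersetCard_prod_le w hw Ω (k + 1)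
      _ ≤ x ^ (k + 1) := pow_le_pow_left₀ hX hx _
      _ = x * x ^ k := by ring
  refine (Finset.sum_le_sum fun k _ => hk k).trans ?_
  rw [← Finset.mul_sum, div_eq_mul_inv, ← tsum_geometric_of_lt_one hx0 hx1]
  exact mul_le_mul_of_nonneg_left
    ((summable_geometric_of_lt_one hx0 hx1).sum_le_tsum _ fun k _ => pow_nonneg hx0 k) hx0

/-! ### The Green function of the discrete Laplacian -/

/-- The convolution kernel `z ^ |n| / (z - z⁻¹)` of the resolvent `(J₀ - (z + z⁻¹))⁻¹`. -/
noncomputable def green (z : ℂ) (n : ℤ) : ℂ := z ^ n.natAbs / (z - z⁻¹)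

lemma sub_inv_ne_zero {z : ℂ} (hz0 : z ≠ 0) (hz : ‖z‖ < 1) : z - z⁻¹ ≠ 0 := by
  intro h
  have h2 : z * z = 1 := by
    rw [sub_eq_zero] at h
    nth_rewrite 2 [h]
    exact mul_inv_cancel₀ hz0
  have h3 := congrArg norm h2
  rw [norm_mul, norm_one] at h3
  nlinarith [norm_nonneg z]

lemma green_add_one (z : ℂ) {n : ℤ} (hn : 0 ≤ n) : green z (n + 1) = z * green z n := by
  rw [green, green, Int.natAbs_add_of_nonneg hn zero_le_one]
  simp only [Int.natAbs_one]
  ring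

lemma green_neg (z : ℂ) (n : ℤ) : green z (-n) = green z n := by
  rw [green, green, Int.natAbs_neg]

lemma green_sub_one (z : ℂ) {n : ℤ} (hn : n ≤ 0) : green z (n - 1) = z * green z n := by
  rw [← green_neg, ← green_neg z n, neg_sub', sub_neg_eq_add, green_add_one z (by omega)]

lemma green_recurrence {z : ℂ} (hz0 : z ≠ 0) (hz : ‖z‖ < 1) (n : ℤ) :
    green z (n - 1) + green z (n + 1) - (z + z⁻¹) * green z n = if n = 0 then 1 else 0 := by
  have hd := sub_inv_ne_zero hz0 hz
  rcases lt_trichotomy n 0 with hn | rfl | hn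
  · have h1 := green_sub_one z (n := n + 1) (by omega)
    rw [add_sub_cancel_right] at h1
    rw [green_sub_one z hn.le, h1, if_neg hn.ne]
    field_simp
    ring
  · rw [green_sub_one z le_rfl, green_add_one z le_rfl, if_pos rfl, green]
    simp only [Int.natAbs_zero, pow_zero]
    rw [← add_mul, ← sub_mul, mul_one_div]
    rw [show z + z - (z + z⁻¹) = z - z⁻¹ by ring]
    exact div_self hd
  · have h1 := green_add_one z (n := n - 1) (by omega)
    rw [sub_add_cancel] at h1
    rw [green_add_one z hn.le, h1, if_neg hn.ne']
    field_simp
    ring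

lemma norm_green_le {z : ℂ} (hz0 : z ≠ 0) (hz : ‖z‖ < 1) (n : ℤ) :
    ‖green z n‖ ≤ ‖omega z‖ / 2 := by
  have hd := sub_inv_ne_zero hz0 hz
  have h1 : omega z = -2 / (z - z⁻¹) := by
    have h2 : (1 : ℂ) - z ^ 2 ≠ 0 := by
      intro h
      apply hd
      have : z⁻¹ = z := inv_eq_of_mul_eq_one_right (by linear_combination -h)
      rw [this, sub_self]
    rw [omega, div_eq_div_iff h2 hd]
    field_simp
    ring
  rw [h1, green, norm_div, norm_div, norm_neg, norm_pow, Complex.norm_ofNat]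
  rw [div_right_comm, div_self two_ne_zero]
  gcongr
  exact pow_le_one₀ (norm_nonneg z) hz.le

lemma summable_norm_green {z : ℂ} (hz : ‖z‖ < 1) : Summable fun n : ℤ => ‖green z n‖ := by
  have h : Summable fun n : ℕ => ‖z‖ ^ n / ‖z - z⁻¹‖ :=
    (summable_geometric_of_lt_one (norm_nonneg z) hz).div_const _
  refine Summable.of_nat_of_neg ?_ ?_ <;> simpa [green, norm_div, norm_pow] using h

lemma summable_norm_green_sub {z : ℂ} (hz : ‖z‖ < 1) (m : ℤ) :
    Summable fun n : ℤ => ‖green z (n - m)‖ :=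
  (Equiv.subRight m).summable_iff (f := fun n : ℤ => ‖green z n‖) |>.2 (summable_norm_green hz)

/-- A bounded sequence `u` is recovered from `(J₀ - (z + z⁻¹)) u` by the Green function. -/
lemma eq_tsum_green_mul {z : ℂ} (hz0 : z ≠ 0) (hz : ‖z‖ < 1) {u : ℤ → ℂ} {C : ℝ}
    (hu : ∀ n, ‖u n‖ ≤ C) (m : ℤ) :
    u m = ∑' n, green z (n - m) * (u (n - 1) + u (n + 1) - (z + z⁻¹) * u n) := by
  have hs : ∀ d e : ℤ, Summable fun n => green z (n + d - m) * u (n + e) := by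
    intro d e
    have h1 : Summable fun n : ℤ => ‖green z (n + d - m)‖ * C :=
      ((Equiv.addRight d).summable_iff.2 (summable_norm_green_sub hz m)).mul_right C
    refine .of_norm_bounded h1 fun n => ?_
    rw [norm_mul]
    exact mul_le_mul_of_nonneg_left (hu _) (norm_nonneg _)
  have h0 : Summable fun n => green z (n - m) * u n := by simpa using hs 0 0
  have hp : ∑' n, green z (n - m) * u (n + 1) = ∑' n, green z (n - 1 - m) * u n := by
    rw [← (Equiv.subRight (1 : ℤ)).tsum_eq fun n => green z (n - m) * u (n + 1)]
    simp
  have hm : ∑' n, green z (n - m) * u (n - 1) = ∑' n, green z (n + 1 - m) * u n := by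
    rw [← (Equiv.addRight (1 : ℤ)).tsum_eq fun n => green z (n - m) * u (n - 1)]
    simp
  have s1 : Summable fun n => green z (n - m) * u (n - 1) := by
    simpa [← sub_eq_add_neg] using hs 0 (-1)
  have s2 : Summable fun n => green z (n - m) * u (n + 1) := by simpa using hs 0 1
  have s3 : Summable fun n => green z (n + 1 - m) * u n := by simpa using hs 1 0
  have s4 : Summable fun n => green z (n - 1 - m) * u n := by
    simpa [← sub_eq_add_neg] using hs (-1) 0
  have e1 : ∀ n, green z (n - m) * (u (n - 1) + u (n + 1) - (z + z⁻¹) * u n) =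
      green z (n - m) * u (n - 1) + green z (n - m) * u (n + 1)
        - (z + z⁻¹) * (green z (n - m) * u n) := fun n => by ring
  have e2 : ∀ n, green z (n + 1 - m) * u n + green z (n - 1 - m) * u n
        - (z + z⁻¹) * (green z (n - m) * u n) = if n = m then u m else 0 := by
    intro n
    have h := green_recurrence hz0 hz (n - m)
    rw [show n - m - 1 = n - 1 - m by ring, show n - m + 1 = n + 1 - m by ring] at h
    rw [← add_mul, ← mul_assoc, ← sub_mul, add_comm (green z _), h]
    simp only [sub_eq_zero]
    split_ifs with hnm
    · rw [hnm, one_mul]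
    · rw [zero_mul]
  rw [tsum_congr e1, (s1.add s2).tsum_sub (h0.mul_left _), s1.tsum_add s2, hm, hp,
    ← s3.tsum_add s4, ← (s3.add s4).tsum_sub (h0.mul_left _), tsum_congr e2, tsum_ite_eq]

/-! ### The free resolvent -/

lemma norm_apply_le (u : L2Z) (k : ℤ) : ‖u k‖ ≤ ‖u‖ :=
  lp.norm_apply_le_norm two_ne_zero u k

lemma norm_shift_le (d : ℤ) : ‖shift d‖ ≤ 1 := by
  refine ContinuousLinearMap.opNorm_le_bound _ zero_le_one fun u => ?_
  rw [one_mul, lp.norm_eq_tsum_rpow (by norm_num), lp.norm_eq_tsum_rpow (by norm_num)]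
  refine le_of_eq (congrArg (· ^ (1 / (2 : ℝ≥0∞).toReal)) ?_)
  exact (Equiv.addRight d).tsum_eq (fun k => ‖u k‖ ^ (2 : ℝ≥0∞).toReal)

/-- `J₀ - (z + z⁻¹) = -z⁻¹ (1 - z S) (1 - z S⁻¹)` with the isometric translation `S`. -/
lemma isUnit_free_sub {z : ℂ} (hz0 : z ≠ 0) (hz : ‖z‖ < 1) :
    IsUnit (JacobiMatrix.free.op - zhukovsky z • ContinuousLinearMap.id ℂ L2Z) := by
  have hu : ∀ d, IsUnit (1 - z • shift d) := fun d =>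
    isUnit_one_sub_of_norm_lt_one <| by
      rw [norm_smul]
      exact (mul_le_of_le_one_right (norm_nonneg z) (norm_shift_le d)).trans_lt hz
  have hc : IsUnit (-z⁻¹ : ℂ) := (neg_ne_zero.2 (inv_ne_zero hz0)).isUnit
  have h := (hc.map (algebraMap ℂ (L2Z →L[ℂ] L2Z))).mul ((hu 1).mul (hu (-1)))
  convert h using 1
  rw [← Algebra.smul_def]
  ext u k
  have h1 : ((-z⁻¹) • ((1 - z • shift 1) * (1 - z • shift (-1)))) u k
      = -z⁻¹ * ((u k - z * u (k + -1)) - z * (u (k + 1) - z * u (k + 1 + -1))) := rfl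
  have h2 : (JacobiMatrix.free.op - zhukovsky z • ContinuousLinearMap.id ℂ L2Z) u k
      = 1 * u (k - 1) + 0 * u k + 1 * u (k + 1) - (z + z⁻¹) * u k := rfl
  rw [h1, h2, add_neg_cancel_right, ← sub_eq_add_neg]
  field_simp
  ring

lemma freeResolvent_single_apply {z : ℂ} (hz0 : z ≠ 0) (hz : ‖z‖ < 1) (i j : ℤ) :
    freeResolvent z (lp.single 2 j (1 : ℂ)) i = green z (i - j) := by
  set g := freeResolvent z (lp.single 2 j (1 : ℂ)) with hg
  have h1 : (JacobiMatrix.free.op - zhukovsky z • ContinuousLinearMap.id ℂ L2Z) g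
      = lp.single 2 j (1 : ℂ) := by
    rw [hg, freeResolvent, if_neg hz0]
    exact congrArg (fun T : L2Z →L[ℂ] L2Z => T (lp.single 2 j (1 : ℂ)))
      (Ring.mul_inverse_cancel _ (isUnit_free_sub hz0 hz))
  have h2 : ∀ n, g (n - 1) + g (n + 1) - (z + z⁻¹) * g n = if n = j then 1 else 0 := by
    intro n
    have h3 := congrArg (fun v : L2Z => v n) h1
    have h4 : (JacobiMatrix.free.op - zhukovsky z • ContinuousLinearMap.id ℂ L2Z) g n
      = 1 * g (n - 1) + 0 * g n + 1 * g (n + 1) - (z + z⁻¹) * g n := rfl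
    simp only [h4, lp.single_apply, Pi.single_apply] at h3
    rw [← h3]
    ring
  rw [eq_tsum_green_mul hz0 hz (norm_apply_le g) i]
  simp only [h2, mul_ite, mul_one, mul_zero]
  rw [tsum_ite_eq, ← green_neg, neg_sub]

/-! ### Diagonal similarity of tridiagonal matrices -/

/-- The tridiagonal matrix with entries `a k` at `(k + 1, k)`, `b k` at `(k, k)` and `c k` at
`(k, k + 1)`. -/
def tridiag (a b c : ℤ → ℂ) (i k : ℤ) : ℂ :=
  (if k = i - 1 then a k else 0) + (if k = i then b i else 0) + (if k = i + 1 then c i else 0)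

lemma sum_tridiag_mul (a b c : ℤ → ℂ) (Ω : Finset ℤ) (i : ℤ) (x : ℤ → ℂ) :
    ∑ k ∈ Ω, tridiag a b c i k * x k = (if i - 1 ∈ Ω then a (i - 1) * x (i - 1) else 0)
      + (if i ∈ Ω then b i * x i else 0) + (if i + 1 ∈ Ω then c i * x (i + 1) else 0) := by
  simp only [tridiag, add_mul, ite_mul, zero_mul, Finset.sum_add_distrib, Finset.sum_ite_eq']

lemma sum_norm_tridiag_le (a b c : ℤ → ℂ) (Ω : Finset ℤ) (i : ℤ) :
    ∑ k ∈ Ω, ‖tridiag a b c i k‖ ≤ ‖a (i - 1)‖ + ‖b i‖ + ‖c i‖ := by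
  calc ∑ k ∈ Ω, ‖tridiag a b c i k‖
      ≤ ∑ k ∈ Ω, ((if k = i - 1 then ‖a (i - 1)‖ else 0) + (if k = i then ‖b i‖ else 0)
          + (if k = i + 1 then ‖c i‖ else 0)) := by
        refine Finset.sum_le_sum fun k _ => (norm_add₃_le).trans (le_of_eq ?_)
        simp only [apply_ite norm, norm_zero]
        congr 2
        exact ite_congr rfl (fun h => by rw [h]) fun _ => rfl
    _ ≤ _ := by
        simp only [Finset.sum_add_distrib, Finset.sum_ite_eq']
        gcongr <;> split_ifs <;> simp

/-- A diagonal similarity that turns the lower diagonal `a` of a tridiagonal matrix into `1`: it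
satisfies `gauge a n = a n * gauge a (n + 1)` and `gauge a 0 = 1`. -/
noncomputable def gauge (a : ℤ → ℂ) (n : ℤ) : ℂ :=
  (∏ k ∈ Finset.Ico 0 n, (a k)⁻¹) * ∏ k ∈ Finset.Ico n 0, a k

lemma gauge_ne_zero {a : ℤ → ℂ} (ha : ∀ n, a n ≠ 0) (n : ℤ) : gauge a n ≠ 0 :=
  mul_ne_zero (Finset.prod_ne_zero_iff.2 fun k _ => inv_ne_zero (ha k))
    (Finset.prod_ne_zero_iff.2 fun k _ => ha k)

lemma gauge_eq_mul {a : ℤ → ℂ} (ha : ∀ n, a n ≠ 0) (n : ℤ) :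
    gauge a n = a n * gauge a (n + 1) := by
  rcases le_or_gt 0 n with hn | hn
  · have h1 : Finset.Ico 0 (n + 1) = insert n (Finset.Ico 0 n) := by
      ext k; simp only [Finset.mem_Ico, Finset.mem_insert]; omega
    rw [gauge, gauge, h1, Finset.prod_insert (by simp), Finset.Ico_eq_empty_of_le hn,
      Finset.Ico_eq_empty_of_le (hn.trans (by omega)), Finset.prod_empty, mul_one, mul_one,
      mul_inv_cancel_left₀ (ha n)]
  · have h1 : Finset.Ico n 0 = insert n (Finset.Ico (n + 1) 0) := by
      ext k; simp only [Finset.mem_Ico, Finset.mem_insert]; omega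
    rw [gauge, gauge, h1, Finset.prod_insert (by simp), Finset.Ico_eq_empty_of_le hn.le,
      Finset.Ico_eq_empty_of_le (by omega : n + 1 ≤ 0), Finset.prod_empty, one_mul, one_mul]

lemma norm_prod_le_exp_tsum {f : ℤ → ℂ} (hf : Summable fun n => ‖1 - f n‖) (s : Finset ℤ) :
    ‖∏ k ∈ s, f k‖ ≤ Real.exp (∑' n, ‖1 - f n‖) := by
  rw [norm_prod]
  calc ∏ k ∈ s, ‖f k‖ ≤ ∏ k ∈ s, (1 + ‖1 - f k‖) :=
        Finset.prod_le_prod (fun k _ => norm_nonneg _) fun k _ => by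
          have := norm_sub_norm_le (f k) 1
          rw [norm_one, norm_sub_rev] at this
          linarith
    _ ≤ Real.exp (∑ k ∈ s, ‖1 - f k‖) := Real.prod_one_add_le_exp_sum s fun k => norm_nonneg _
    _ ≤ _ := Real.exp_le_exp.2 (hf.sum_le_tsum s fun k _ => norm_nonneg _)

lemma exists_norm_gauge_le {a : ℤ → ℂ} (ha : ∀ n, a n ≠ 0)
    (hs : Summable fun n => ‖1 - a n‖) : ∃ C : ℝ, ∀ n, ‖gauge a n‖ ≤ C := by
  have hinv : Summable fun n => ‖1 - (a n)⁻¹‖ := by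
    refine .of_norm_bounded_eventually (hs.mul_left 2) ?_
    filter_upwards [hs.tendsto_cofinite_zero.eventually_lt_const
      (show (0 : ℝ) < 1 / 2 by norm_num)] with n hn
    have h1 : 1 / 2 ≤ ‖a n‖ := by
      have := norm_sub_norm_le 1 (a n)
      rw [norm_one] at this
      linarith
    have h2 : 1 - (a n)⁻¹ = -(1 - a n) * (a n)⁻¹ := by
      field_simp [ha n]
      ring
    rw [norm_norm, h2, norm_mul, norm_neg, norm_inv, mul_comm]
    refine mul_le_mul_of_nonneg_right ?_ (norm_nonneg _)
    exact inv_le_of_inv_le₀ (by norm_num) (by linarith)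
  refine ⟨Real.exp (∑' n, ‖1 - (a n)⁻¹‖) * Real.exp (∑' n, ‖1 - a n‖), fun n => ?_⟩
  rw [gauge, norm_mul]
  exact mul_le_mul (norm_prod_le_exp_tsum hinv _) (norm_prod_le_exp_tsum hs _) (norm_nonneg _)
    (Real.exp_pos _).le

/-! ### Truncated perturbation determinants -/

/-- The diagonal of the inverse of the Green function compressed to `{p, …, q}`: the compression
of `J₀ - (z + z⁻¹)`, corrected by `z` at both ends. -/
noncomputable def boundaryDiag (z : ℂ) (p q i : ℤ) : ℂ :=
  -(z + z⁻¹) + (if i = p then z else 0) + (if i = q then z else 0)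

lemma sum_tridiag_boundaryDiag_mul_green {z : ℂ} (hz0 : z ≠ 0) (hz : ‖z‖ < 1) {p q i j : ℤ}
    (hi : i ∈ Finset.Icc p q) (hj : j ∈ Finset.Icc p q) :
    ∑ k ∈ Finset.Icc p q,
      tridiag (fun _ => 1) (boundaryDiag z p q) (fun _ => 1) i k * green z (k - j)
        = if i = j then 1 else 0 := by
  rw [sum_tridiag_mul, if_pos hi]
  rw [Finset.mem_Icc] at hi hj
  have h := green_recurrence hz0 hz (i - j)
  rw [show i - j - 1 = i - 1 - j by ring, show i - j + 1 = i + 1 - j by ring] at h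
  simp only [sub_eq_zero] at h
  rw [← h, boundaryDiag]
  have hl : (if i - 1 ∈ Finset.Icc p q then (1 : ℂ) * green z (i - 1 - j) else 0)
      = green z (i - 1 - j) - (if i = p then z else 0) * green z (i - j) := by
    by_cases hp : i = p
    · have := green_sub_one z (n := i - j) (by omega)
      rw [show i - j - 1 = i - 1 - j by ring] at this
      rw [if_neg (by rw [Finset.mem_Icc]; omega), if_pos hp, this, sub_self]
    · rw [if_pos (by rw [Finset.mem_Icc]; omega), if_neg hp, one_mul, zero_mul, sub_zero]
  have hr : (if i + 1 ∈ Finset.Icc p q then (1 : ℂ) * green z (i + 1 - j) else 0)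
      = green z (i + 1 - j) - (if i = q then z else 0) * green z (i - j) := by
    by_cases hq : i = q
    · have := green_add_one z (n := i - j) (by omega)
      rw [show i - j + 1 = i + 1 - j by ring] at this
      rw [if_neg (by rw [Finset.mem_Icc]; omega), if_pos hq, this, sub_self]
    · rw [if_pos (by rw [Finset.mem_Icc]; omega), if_neg hq, one_mul, zero_mul, sub_zero]
  rw [hl, hr]
  ring

/-- The matrix of `V G`, where `V` is the tridiagonal matrix of `J(a, b, c) - J₀` and `G` the
Green function, with the inner summation restricted to `Ω`. -/
noncomputable def truncatedKernel (z : ℂ) (a b c : ℤ → ℂ) (Ω : Finset ℤ) (i j : ℤ) : ℂ :=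
  ∑ k ∈ Ω, tridiag (fun n => a n - 1) b (fun n => c n - 1) i k * green z (k - j)

lemma one_add_truncatedKernel {z : ℂ} (hz0 : z ≠ 0) (hz : ‖z‖ < 1) (a b c : ℤ → ℂ) (p q : ℤ) :
    1 + (Matrix.of fun i j : Finset.Icc p q => truncatedKernel z a b c (Finset.Icc p q) i j)
      = (Matrix.of fun i k : Finset.Icc p q =>
          tridiag a (fun n => b n + boundaryDiag z p q n) c i k)
        * Matrix.of fun k j : Finset.Icc p q => green z (k - j) := by
  ext i j
  have h1 : (1 : Matrix (Finset.Icc p q) (Finset.Icc p q) ℂ) i j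
      = if (i : ℤ) = j then 1 else 0 := by
    simp only [Matrix.one_apply, Subtype.ext_iff]
  rw [Matrix.add_apply, h1, ← sum_tridiag_boundaryDiag_mul_green hz0 hz i.2 j.2, Matrix.mul_apply]
  simp only [Matrix.of_apply]
  rw [Finset.sum_coe_sort (Finset.Icc p q) fun k =>
    tridiag a (fun n => b n + boundaryDiag z p q n) c i k * green z (k - j), truncatedKernel,
    ← Finset.sum_add_distrib]
  refine Finset.sum_congr rfl fun k _ => ?_
  rw [← add_mul]
  congr 1
  simp only [tridiag]
  split_ifs <;> ring

/-- The truncated perturbation determinant depends on `a` and `c` only through `a * c`. -/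
lemma det_one_add_truncatedKernel {z : ℂ} (hz0 : z ≠ 0) (hz : ‖z‖ < 1) {a : ℤ → ℂ}
    (ha : ∀ n, a n ≠ 0) (b c : ℤ → ℂ) (p q : ℤ) :
    (1 + Matrix.of fun i j : Finset.Icc p q =>
        truncatedKernel z a b c (Finset.Icc p q) i j).det
      = (1 + Matrix.of fun i j : Finset.Icc p q =>
        truncatedKernel z (fun _ => 1) b (fun n => a n * c n) (Finset.Icc p q) i j).det := by
  rw [one_add_truncatedKernel hz0 hz, one_add_truncatedKernel hz0 hz, Matrix.det_mul,
    Matrix.det_mul]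
  congr 1
  set β := fun n => b n + boundaryDiag z p q n
  set D : Matrix (Finset.Icc p q) (Finset.Icc p q) ℂ := Matrix.diagonal fun i => gauge a i
  have hD : D.det ≠ 0 := by
    rw [Matrix.det_diagonal]
    exact Finset.prod_ne_zero_iff.2 fun i _ => gauge_ne_zero ha _
  refine mul_left_cancel₀ hD ?_
  rw [mul_comm D.det (Matrix.det (Matrix.of fun i k : Finset.Icc p q =>
    tridiag (fun _ => 1) β (fun n => a n * c n) i k)), ← Matrix.det_mul, ← Matrix.det_mul]
  congr 1
  ext i k
  rw [Matrix.diagonal_mul, Matrix.mul_diagonal, Matrix.of_apply, Matrix.of_apply]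
  simp only [tridiag, mul_add, add_mul, mul_ite, ite_mul, mul_zero, zero_mul, one_mul]
  congr 1
  · congr 1
    · refine ite_congr rfl (fun h => ?_) fun _ => rfl
      rw [gauge_eq_mul ha k, h, sub_add_cancel, mul_comm]
    · refine ite_congr rfl (fun h => ?_) fun _ => rfl
      rw [h, mul_comm]
  · refine ite_congr rfl (fun h => ?_) fun _ => rfl
    rw [gauge_eq_mul ha i, h]
    ring

lemma norm_truncatedKernel_one_le {z : ℂ} (hz0 : z ≠ 0) (hz : ‖z‖ < 1) (b c : ℤ → ℂ)
    (Ω : Finset ℤ) (i j : ℤ) :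
    ‖truncatedKernel z (fun _ => 1) b c Ω i j‖ ≤ (‖b i‖ + ‖1 - c i‖) * (‖omega z‖ / 2) := by
  refine (norm_sum_le _ _).trans ?_
  calc ∑ k ∈ Ω, ‖tridiag (fun _ => 1 - 1) b (fun n => c n - 1) i k * green z (k - j)‖
      ≤ ∑ k ∈ Ω, ‖tridiag (fun _ => 1 - 1) b (fun n => c n - 1) i k‖ * (‖omega z‖ / 2) := by
        refine Finset.sum_le_sum fun k _ => ?_
        rw [norm_mul]
        exact mul_le_mul_of_nonneg_left (norm_green_le hz0 hz _) (norm_nonneg _)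
    _ ≤ _ := by
        rw [← Finset.sum_mul]
        refine mul_le_mul_of_nonneg_right ?_ (by positivity)
        have := sum_norm_tridiag_le (fun _ => 1 - 1) b (fun n => c n - 1) Ω i
        simpa [norm_sub_rev] using this

/-! ### The perturbation determinant as a limit -/

lemma op_sub_free_apply (J : JacobiMatrix) (u : L2Z) (k : ℤ) :
    (J.op - JacobiMatrix.free.op) u k
      = (J.a (k - 1) - 1) * u (k - 1) + J.b k * u k + (J.c k - 1) * u (k + 1) := by
  have h : (J.op - JacobiMatrix.free.op) u k
    = J.a (k - 1) * u (k - 1) + J.b k * u k + J.c k * u (k + 1)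
      - (1 * u (k - 1) + 0 * u k + 1 * u (k + 1)) := rfl
  rw [h]
  ring

lemma entry_eq_truncatedKernel {z : ℂ} (hz0 : z ≠ 0) (hz : ‖z‖ < 1) (J : JacobiMatrix)
    {Ω : Finset ℤ} {i : ℤ} (hi : Finset.Icc (i - 1) (i + 1) ⊆ Ω) (j : ℤ) :
    truncatedKernel z J.a J.b J.c Ω i j
      = entry ((J.op - JacobiMatrix.free.op) ∘L freeResolvent z) i j := by
  rw [entry, ContinuousLinearMap.comp_apply, op_sub_free_apply, truncatedKernel, sum_tridiag_mul,
    if_pos (hi (Finset.mem_Icc.2 (by omega))), if_pos (hi (Finset.mem_Icc.2 (by omega))),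
    if_pos (hi (Finset.mem_Icc.2 (by omega)))]
  simp only [freeResolvent_single_apply hz0 hz]

/-- Thanks to the decay of the Green function, the minors of `V G` are dominated by a summable
family of products over their rows, so that truncation to `{-N, …, N}` passes to the limit. -/
lemma tendsto_det_one_add_truncatedKernel {z : ℂ} (hz0 : z ≠ 0) (hz : ‖z‖ < 1) {J : JacobiMatrix}
    (hJ : J.IsTraceClassPerturbation) :
    Filter.Tendsto (fun N : ℕ => (1 + Matrix.of fun i j : Finset.Icc (-(N : ℤ)) N =>
        truncatedKernel z J.a J.b J.c (Finset.Icc (-(N : ℤ)) N) i j).det)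
      Filter.atTop (𝓝 (perturbationDet z J)) := by
  set K := ∑' n, ‖green z n‖
  have hK0 : 0 ≤ K := tsum_nonneg fun n => norm_nonneg _
  set v : ℤ → ℝ := fun i => ‖J.a (i - 1) - 1‖ + ‖J.b i‖ + ‖J.c i - 1‖
  have hv0 : ∀ i, 0 ≤ v i := fun i => by positivity
  have hv : Summable v := by
    have h1 : Summable fun n => ‖J.a n - 1‖ := hJ.of_nonneg_of_le (fun n => norm_nonneg _)
      fun n => by rw [norm_sub_rev]; linarith [norm_nonneg (J.b n), norm_nonneg (1 - J.c n)]
    have h2 : Summable fun n => ‖J.b n‖ + ‖J.c n - 1‖ :=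
      hJ.of_nonneg_of_le (fun n => by positivity)
        fun n => by rw [norm_sub_rev]; linarith [norm_nonneg (1 - J.a n)]
    have h3 := ((Equiv.subRight (1 : ℤ)).summable_iff.2 h1).add h2
    simpa [v, Function.comp_def, add_assoc] using h3
  have hrow : ∀ (Ω S : Finset ℤ) (i : ℤ),
      ∑ j ∈ S, ‖truncatedKernel z J.a J.b J.c Ω i j‖ ≤ v i * K := by
    intro Ω S i
    calc ∑ j ∈ S, ‖truncatedKernel z J.a J.b J.c Ω i j‖
        ≤ ∑ j ∈ S, ∑ k ∈ Ω, ‖tridiag (fun n => J.a n - 1) J.b (fun n => J.c n - 1) i k‖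
            * ‖green z (k - j)‖ := by
          refine Finset.sum_le_sum fun j _ => (norm_sum_le _ _).trans (le_of_eq ?_)
          simp only [norm_mul]
      _ = ∑ k ∈ Ω, ‖tridiag (fun n => J.a n - 1) J.b (fun n => J.c n - 1) i k‖
            * ∑ j ∈ S, ‖green z (k - j)‖ := by
          rw [Finset.sum_comm]
          simp only [Finset.mul_sum]
      _ ≤ ∑ k ∈ Ω, ‖tridiag (fun n => J.a n - 1) J.b (fun n => J.c n - 1) i k‖ * K := by
          refine Finset.sum_le_sum fun k _ => mul_le_mul_of_nonneg_left ?_ (norm_nonneg _)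
          have h1 := (Equiv.subLeft k).summable_iff.2 (summable_norm_green hz)
          refine (h1.sum_le_tsum S fun _ _ => norm_nonneg _).trans (le_of_eq ?_)
          exact (Equiv.subLeft k).tsum_eq fun n => ‖green z n‖
      _ ≤ v i * K := by
          rw [← Finset.sum_mul]
          exact mul_le_mul_of_nonneg_right (sum_norm_tridiag_le _ _ _ Ω i) hK0
  have hlim := tendsto_tsum_of_dominated_convergence (𝓕 := Filter.atTop)
    (f := fun (N : ℕ) (S : Finset ℤ) => if S ∈ (Finset.Icc (-(N : ℤ)) N).powerset then
      (Matrix.of fun i j : S =>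
        truncatedKernel z J.a J.b J.c (Finset.Icc (-(N : ℤ)) N) i j).det else 0)
    (g := fun S : Finset ℤ => (Matrix.of fun i j : S =>
      entry ((J.op - JacobiMatrix.free.op) ∘L freeResolvent z) i j).det)
    (bound := fun S => ∏ i ∈ S, v i * K)
    (summable_finsetProd_of_summable_nonneg (fun i => mul_nonneg (hv0 i) hK0) (hv.mul_right K))
    ?_ (Filter.Eventually.of_forall ?_)
  · rw [perturbationDet, fredholmDet]
    refine hlim.congr fun N => ?_
    rw [det_one_add_eq_sum_principal_minors, tsum_eq_sum fun S hS => if_neg hS]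
    exact Finset.sum_congr rfl fun S hS => if_pos hS
  · intro S
    obtain ⟨M, hM⟩ : ∃ M : ℕ, ∀ i ∈ S, i.natAbs ≤ M :=
      ⟨S.sup Int.natAbs, fun i hi => Finset.le_sup hi⟩
    refine tendsto_const_nhds.congr' ?_
    filter_upwards [Filter.eventually_ge_atTop (M + 1)] with N hN
    rw [if_pos]
    · congr 2
      ext i j
      refine (entry_eq_truncatedKernel hz0 hz J (fun k hk => ?_) j).symm
      have := hM i i.2
      rw [Finset.mem_Icc] at hk ⊢
      omega
    · rw [Finset.mem_powerset]
      intro i hi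
      have := hM i hi
      rw [Finset.mem_Icc]
      omega
  · intro N S
    split_ifs with h
    · refine (norm_det_le_prod_sum _).trans ?_
      rw [← Finset.prod_coe_sort S fun i => v i * K]
      refine Finset.prod_le_prod (fun i _ => by positivity) fun i _ => ?_
      refine le_trans (le_of_eq ?_) (hrow (Finset.Icc (-(N : ℤ)) N) S i)
      exact Finset.sum_coe_sort S fun j =>
        ‖truncatedKernel z J.a J.b J.c (Finset.Icc (-(N : ℤ)) N) i j‖
    · rw [norm_zero]
      exact Finset.prod_nonneg fun i _ => mul_nonneg (hv0 i) hK0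

lemma delta_nonneg (J : JacobiMatrix) : 0 ≤ J.Delta := tsum_nonneg fun n => by positivity

lemma summable_delta {J : JacobiMatrix} (hJ : J.IsTraceClassPerturbation) :
    Summable fun n : ℤ => ‖J.b n‖ + ‖1 - J.a n * J.c n‖ := by
  obtain ⟨M, hM⟩ := J.bounded
  have hM0 : 0 ≤ M := (norm_nonneg _).trans (hM 0).1
  refine (hJ.mul_left (1 + M)).of_nonneg_of_le (fun n => by positivity) fun n => ?_
  have h1 : ‖1 - J.a n * J.c n‖ ≤ ‖1 - J.a n‖ + M * ‖1 - J.c n‖ := by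
    have h2 : 1 - J.a n * J.c n = (1 - J.a n) + J.a n * (1 - J.c n) := by ring
    rw [h2]
    refine (norm_add_le _ _).trans ?_
    rw [norm_mul]
    gcongr
    exact (hM n).1
  have := mul_nonneg hM0 (norm_nonneg (1 - J.a n))
  have := mul_nonneg hM0 (norm_nonneg (J.b n))
  have := norm_nonneg (1 - J.c n)
  linarith

lemma perturbationDet_zero (J : JacobiMatrix) : perturbationDet 0 J = 1 := by
  rw [perturbationDet, fredholmDet, tsum_eq_single ∅]
  · exact Matrix.det_isEmpty
  · intro S hS
    obtain ⟨i, hi⟩ := Finset.nonempty_iff_ne_empty.2 hS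
    refine Matrix.det_eq_zero_of_row_eq_zero ⟨i, hi⟩ fun j => ?_
    rw [Matrix.of_apply, entry, freeResolvent, if_pos rfl, ContinuousLinearMap.comp_zero]
    rfl

/-- The Birman–Schwinger bound for the perturbation determinant. -/
lemma norm_perturbationDet_sub_one_le {z : ℂ} (hz : ‖z‖ < 1) {J : JacobiMatrix}
    (hJ : J.IsTraceClassPerturbation) (h : J.Delta * (‖omega z‖ / 2) < 1) :
    ‖perturbationDet z J - 1‖
      ≤ J.Delta * (‖omega z‖ / 2) / (1 - J.Delta * (‖omega z‖ / 2)) := by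
  rcases eq_or_ne z 0 with rfl | hz0
  · simp [perturbationDet_zero, omega]
  · have ha : ∀ n, J.a n ≠ 0 := fun n => left_ne_zero_of_mul (J.ne_zero n)
    refine le_of_tendsto ((tendsto_det_one_add_truncatedKernel hz0 hz hJ).sub_const 1).norm
      (Filter.Eventually.of_forall fun N => ?_)
    rw [det_one_add_truncatedKernel hz0 hz ha]
    refine norm_det_one_add_sub_one_le _ _ _
      (norm_truncatedKernel_one_le hz0 hz J.b (fun n => J.a n * J.c n) _) ?_ h
    rw [← Finset.sum_mul]
    refine mul_le_mul_of_nonneg_right ?_ (by positivity)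
    exact (summable_delta hJ).sum_le_tsum _ fun n _ => by positivity

/-! ### The interval `[-2, 2]` has no point of the discrete spectrum -/

lemma op_single (J : JacobiMatrix) (j : ℤ) :
    J.op (lp.single 2 j (1 : ℂ)) = J.a j • lp.single 2 (j + 1) (1 : ℂ)
      + J.b j • lp.single 2 j (1 : ℂ) + J.c (j - 1) • lp.single 2 (j - 1) (1 : ℂ) := by
  ext k
  rw [JacobiMatrix.op_apply]
  simp only [lp.coeFn_add, lp.coeFn_smul, Pi.add_apply, Pi.smul_apply, lp.single_apply,
    Pi.single_apply, smul_eq_mul, mul_ite, mul_one, mul_zero]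
  congr 1
  · congr 1
    · by_cases h : k = j + 1
      · rw [if_pos (by omega), if_pos h, h, add_sub_cancel_right]
      · rw [if_neg (by omega), if_neg h]
    · by_cases h : k = j
      · rw [if_pos h, if_pos h, h]
      · rw [if_neg h, if_neg h]
  · by_cases h : k = j - 1
    · rw [if_pos (by omega), if_pos h, h]
    · rw [if_neg (by omega), if_neg h]

/-- The plane wave `∑_{k < N} w ^ k e_k`. -/
noncomputable def planeWave (w : ℂ) (N : ℕ) : L2Z :=
  ∑ k ∈ Finset.range N, w ^ k • lp.single 2 (k : ℤ) (1 : ℂ)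

lemma norm_planeWave_sq {w : ℂ} (hw : ‖w‖ = 1) (N : ℕ) : ‖planeWave w N‖ ^ 2 = N := by
  have h := lp.norm_sum_single (p := 2) (E := fun _ : ℤ => ℂ) (by norm_num)
    (fun i => w ^ i.toNat) ((Finset.range N).map Nat.castEmbedding)
  simp only [Finset.sum_map, Nat.castEmbedding_apply, Int.toNat_natCast, norm_pow, hw, one_pow,
    ENNReal.toReal_ofNat, Real.rpow_ofNat, Finset.sum_const, Finset.card_map, Finset.card_range,
    nsmul_eq_mul, mul_one] at h
  rw [← h, planeWave]
  refine congrArg (fun v : L2Z => ‖v‖ ^ 2) (Finset.sum_congr rfl fun k _ => ?_)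
  rw [← lp.single_smul, smul_eq_mul, mul_one]

/-- Apart from two boundary terms, `J - (w + w⁻¹)` sees only the perturbation `J - J₀` on a plane
wave, so that its value stays bounded as the plane wave grows. -/
lemma norm_op_planeWave_le {J : JacobiMatrix} (hJ : J.IsTraceClassPerturbation) {w : ℂ}
    (hw : ‖w‖ = 1) : ∃ K : ℝ, ∀ N,
      ‖J.op (planeWave w N) - (w + w⁻¹) • planeWave w N‖ ≤ K := by
  have hw0 : w ≠ 0 := norm_ne_zero_iff.1 (by rw [hw]; exact one_ne_zero)
  let e : ℤ → L2Z := fun j => lp.single 2 j (1 : ℂ)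
  have he : ∀ j, ‖e j‖ = 1 := fun j => by
    rw [lp.norm_single (by norm_num), norm_one]
  -- `J₀ - (w + w⁻¹)` maps the `k`-th term of the plane wave to `E (k + 1) - E k`
  let E : ℕ → L2Z := fun k => (w⁻¹ * w ^ k) • e k - w ^ k • e (k - 1)
  have hE : ∀ k, ‖E k‖ ≤ 2 := fun k => by
    refine (norm_sub_le _ _).trans ?_
    rw [norm_smul, norm_smul, he, he, norm_mul, norm_inv, norm_pow, hw]
    norm_num
  let F : ℕ → L2Z := fun k => w ^ k • ((J.a k - 1) • e (k + 1) + J.b k • e k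
    + (J.c (k - 1) - 1) • e (k - 1))
  have hs : ∀ N, J.op (planeWave w N) - (w + w⁻¹) • planeWave w N
      = ∑ k ∈ Finset.range N, F k + (E N - E 0) := by
    intro N
    rw [← Finset.sum_range_sub, ← Finset.sum_add_distrib, planeWave, map_sum, Finset.smul_sum,
      ← Finset.sum_sub_distrib]
    refine Finset.sum_congr rfl fun k _ => ?_
    rw [map_smul, op_single]
    simp only [F, E, e]
    push_cast
    rw [add_sub_cancel_right]
    have h1 : w⁻¹ * w ^ (k + 1) = w ^ k := by
      field_simp
      ring
    rw [h1]
    match_scalars <;> ring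
  let t : ℤ → ℝ := fun n => ‖1 - J.a n‖ + ‖J.b n‖ + ‖1 - J.c n‖
  have ht : Summable t := hJ
  have ht' : Summable fun n : ℤ => t (n - 1) := (Equiv.subRight (1 : ℤ)).summable_iff.2 ht
  have ht0 : ∀ n, 0 ≤ t n := fun n => by positivity
  have hT : Summable fun k : ℕ => t k + t (k - 1) :=
    (ht.add ht').comp_injective Nat.cast_injective
  have hF : ∀ k, ‖F k‖ ≤ t k + t (k - 1) := by
    intro k
    simp only [F, norm_smul, norm_pow, hw, one_pow, one_mul]
    refine norm_add₃_le.trans ?_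
    rw [norm_smul, norm_smul, norm_smul, he, he, he, norm_sub_rev, norm_sub_rev (J.c _)]
    simp only [t]
    have := norm_nonneg (1 - J.c k)
    have := norm_nonneg (1 - J.a (k - 1))
    have := norm_nonneg (J.b (k - 1))
    linarith
  refine ⟨∑' k : ℕ, (t k + t (k - 1)) + (2 + 2), fun N => ?_⟩
  rw [hs]
  refine (norm_add_le _ _).trans (add_le_add ?_ ((norm_sub_le _ _).trans
    (add_le_add (hE N) (hE 0))))
  refine (norm_sum_le _ _).trans ((Finset.sum_le_sum fun k _ => hF k).trans ?_)
  exact hT.sum_le_tsum _ fun k _ => add_nonneg (ht0 _) (ht0 _)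

lemma ofReal_mem_spectrum {J : JacobiMatrix} (hJ : J.IsTraceClassPerturbation) {x : ℝ}
    (hx : x ∈ Set.Icc (-2 : ℝ) 2) : (x : ℂ) ∈ spectrum ℂ J.op := by
  by_contra h
  rw [spectrum.notMem_iff] at h
  obtain ⟨R, hR⟩ := h.exists_left_inv
  set w : ℂ := Complex.exp (Real.arccos (x / 2) * Complex.I)
  have hw : ‖w‖ = 1 := Complex.norm_exp_ofReal_mul_I _
  have hwx : w + w⁻¹ = x := by
    have h1 : Complex.cos (Real.arccos (x / 2) : ℝ) = (x / 2 : ℝ) := by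
      rw [← Complex.ofReal_cos, Real.cos_arccos (by linarith [hx.1]) (by linarith [hx.2])]
    rw [← Complex.exp_neg, ← neg_mul, ← Complex.two_cos, h1]
    push_cast
    ring
  obtain ⟨K, hK⟩ := norm_op_planeWave_le hJ hw
  rw [hwx] at hK
  have hb : ∀ N : ℕ, (N : ℝ) ≤ (‖R‖ * K) ^ 2 := by
    intro N
    set v := planeWave w N
    have h1 : v = R (algebraMap ℂ (L2Z →L[ℂ] L2Z) x v - J.op v) :=
      (congrArg (fun T : L2Z →L[ℂ] L2Z => T v) hR).symm
    have h2 : algebraMap ℂ (L2Z →L[ℂ] L2Z) x v - J.op v = -(J.op v - (x : ℂ) • v) := by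
      rw [neg_sub]
      rfl
    rw [h2] at h1
    rw [← norm_planeWave_sq hw N]
    refine pow_le_pow_left₀ (norm_nonneg _) ?_ 2
    calc ‖v‖ = ‖R (-(J.op v - (x : ℂ) • v))‖ := congrArg norm h1
      _ ≤ ‖R‖ * ‖-(J.op v - (x : ℂ) • v)‖ := R.le_opNorm _
      _ ≤ ‖R‖ * K := by
        rw [norm_neg]
        exact mul_le_mul_of_nonneg_left (hK N) (norm_nonneg _)
  obtain ⟨N, hN⟩ := exists_nat_gt ((‖R‖ * K) ^ 2)
  exact (hb N).not_gt hN

lemma notMem_image_Icc_of_mem_discreteSpectrum {J : JacobiMatrix}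
    (hJ : J.IsTraceClassPerturbation) {μ : ℂ} (hμ : μ ∈ J.discreteSpectrum) :
    μ ∉ Complex.ofReal '' Set.Icc (-2) 2 := by
  rintro ⟨x, hx, rfl⟩
  have h := hμ.1
  rw [eventually_nhdsWithin_iff, Metric.eventually_nhds_iff] at h
  obtain ⟨ε, hε, h⟩ := h
  -- a point of `[-2, 2]` closer than `ε` to `x`, on the side of `x` that has more room
  obtain ⟨y, hy, hne, hd⟩ : ∃ y ∈ Set.Icc (-2 : ℝ) 2, y ≠ x ∧ |y - x| < ε := by
    have hm : 0 < min (ε / 2) 1 := lt_min (half_pos hε) one_pos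
    have hm1 : min (ε / 2) 1 ≤ 1 := min_le_right _ _
    have hm2 : min (ε / 2) 1 ≤ ε / 2 := min_le_left _ _
    obtain ⟨hx1, hx2⟩ := hx
    rcases le_total x 0 with h0 | h0
    · refine ⟨x + min (ε / 2) 1, ⟨by linarith, by linarith⟩, by linarith, ?_⟩
      rw [add_sub_cancel_left, abs_of_pos hm]
      linarith
    · refine ⟨x - min (ε / 2) 1, ⟨by linarith, by linarith⟩, by linarith, ?_⟩
      rw [sub_sub_cancel_left, abs_neg, abs_of_pos hm]
      linarith
  refine h (y := (y : ℂ)) ?_ (by simpa using hne) (ofReal_mem_spectrum hJ hy)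
  rwa [Complex.dist_eq, ← Complex.ofReal_sub, Complex.norm_real, Real.norm_eq_abs]

/-! ### Eigenvectors -/

/-- The Birman–Schwinger bound for eigenvalues: in the gauge `J(1, b, a c)` an eigenvector is a
bounded sequence that the Green function and the perturbation reproduce, and this is a contraction
in the supremum norm. -/
lemma eq_zero_of_op_eq_smul {z : ℂ} (hz0 : z ≠ 0) (hz : ‖z‖ < 1) {J : JacobiMatrix}
    (hJ : J.IsTraceClassPerturbation) (h : J.Delta * (‖omega z‖ / 2) < 1) {u : L2Z}
    (hu : J.op u = zhukovsky z • u) : u = 0 := by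
  have ha : ∀ n, J.a n ≠ 0 := fun n => left_ne_zero_of_mul (J.ne_zero n)
  obtain ⟨C, hC⟩ := exists_norm_gauge_le ha <| hJ.of_nonneg_of_le (fun n => norm_nonneg _)
    fun n => by linarith [norm_nonneg (J.b n), norm_nonneg (1 - J.c n)]
  set x : ℤ → ℂ := fun n => gauge J.a n * u n with hx
  have hxC : ∀ n, ‖x n‖ ≤ C * ‖u‖ := fun n => by
    rw [hx, norm_mul]
    exact mul_le_mul (hC n) (norm_apply_le u n) (norm_nonneg _) ((norm_nonneg _).trans (hC n))
  have hbdd : BddAbove (Set.range fun n => ‖x n‖) := ⟨C * ‖u‖, by rintro _ ⟨n, rfl⟩; exact hxC n⟩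
  set B := ⨆ n, ‖x n‖
  have hB : ∀ n, ‖x n‖ ≤ B := le_ciSup hbdd
  have hB0 : 0 ≤ B := (norm_nonneg _).trans (hB 0)
  have hrec : ∀ n, x (n - 1) + x (n + 1) - (z + z⁻¹) * x n
      = -(J.b n * x n - (1 - J.a n * J.c n) * x (n + 1)) := by
    intro n
    have h1 : J.a (n - 1) * u (n - 1) + J.b n * u n + J.c n * u (n + 1) = (z + z⁻¹) * u n :=
      congrArg (fun v : L2Z => v n) hu
    have h2 := gauge_eq_mul ha (n - 1)
    rw [sub_add_cancel] at h2
    simp only [hx]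
    rw [h2]
    have h3 := gauge_eq_mul ha n
    linear_combination gauge J.a n * h1 - J.c n * u (n + 1) * h3
  have hle : ∀ m, ‖x m‖ ≤ J.Delta * (‖omega z‖ / 2) * B := by
    intro m
    rw [eq_tsum_green_mul hz0 hz hxC m]
    have hs := ((summable_delta hJ).mul_right (‖omega z‖ / 2)).mul_right B
    refine (tsum_of_norm_bounded hs.hasSum fun n => ?_).trans (le_of_eq ?_)
    · rw [hrec, norm_mul, norm_neg]
      have h1 : ‖J.b n * x n - (1 - J.a n * J.c n) * x (n + 1)‖
          ≤ (‖J.b n‖ + ‖1 - J.a n * J.c n‖) * B := by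
        refine (norm_sub_le _ _).trans ?_
        rw [norm_mul (J.b n), norm_mul (1 - _), add_mul]
        exact add_le_add (mul_le_mul_of_nonneg_left (hB _) (norm_nonneg _))
          (mul_le_mul_of_nonneg_left (hB _) (norm_nonneg _))
      refine (mul_le_mul (norm_green_le hz0 hz _) h1 (norm_nonneg _) (by positivity)).trans
        (le_of_eq (by ring))
    · rw [tsum_mul_right, tsum_mul_right, JacobiMatrix.Delta]
  have hBle : B ≤ J.Delta * (‖omega z‖ / 2) * B := ciSup_le hle
  have hBz : B ≤ 0 := by nlinarith
  ext n
  have hxn : x n = 0 := norm_le_zero_iff.1 ((hB n).trans hBz)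
  exact (mul_eq_zero.1 hxn).resolve_left (gauge_ne_zero ha n)

/-! ### The Zhukovsky function -/

lemma exists_zhukovsky_eq {μ : ℂ} (hμ : μ ∉ Complex.ofReal '' Set.Icc (-2) 2) :
    ∃ z : ℂ, z ≠ 0 ∧ ‖z‖ < 1 ∧ zhukovsky z = μ := by
  obtain ⟨s, hs⟩ := IsAlgClosed.exists_pow_nat_eq (μ ^ 2 - 4) two_pos
  have hprod : (μ + s) / 2 * ((μ - s) / 2) = 1 := by linear_combination -hs / 4
  -- the preimages of `μ` are the roots of `z ^ 2 - μ z + 1`, whose product is `1`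
  have key : ∀ z y : ℂ, z * y = 1 → z + y = μ → ‖z‖ ≤ 1 →
      ∃ z : ℂ, z ≠ 0 ∧ ‖z‖ < 1 ∧ zhukovsky z = μ := by
    intro z y hzy hsum hz1
    have hz0 : z ≠ 0 := left_ne_zero_of_mul_eq_one hzy
    have hy : z⁻¹ = y := inv_eq_of_mul_eq_one_right hzy
    have hzh : z + z⁻¹ = μ := by rw [hy, hsum]
    refine ⟨z, hz0, lt_of_le_of_ne hz1 fun h1 => hμ ⟨2 * z.re, ?_, ?_⟩, hzh⟩
    · have := abs_le.1 ((Complex.abs_re_le_norm z).trans hz1)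
      exact ⟨by linarith, by linarith⟩
    · rw [← hzh, Complex.inv_eq_conj h1, Complex.add_conj]
  rcases le_total ‖(μ + s) / 2‖ 1 with h1 | h1
  · exact key _ _ hprod (by ring) h1
  · refine key _ _ ((mul_comm _ _).trans hprod) (by ring) ?_
    have h2 := congrArg norm hprod
    rw [norm_mul, norm_one] at h2
    nlinarith [norm_nonneg ((μ - s) / 2)]

lemma norm_omega_sq_mul {z : ℂ} (hz0 : z ≠ 0) (hz : ‖z‖ < 1) :
    ‖omega z‖ ^ 2 * ‖zhukovsky z ^ 2 - 4‖ = 4 := by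
  have h1 : (1 : ℂ) - z ^ 2 ≠ 0 := by
    intro h
    apply sub_inv_ne_zero hz0 hz
    rw [inv_eq_of_mul_eq_one_right (show z * z = 1 by linear_combination -h), sub_self]
  have h2 : omega z ^ 2 * (zhukovsky z ^ 2 - 4) = 4 := by
    rw [omega, zhukovsky]
    field_simp
    ring
  rw [← norm_pow, ← norm_mul, h2, Complex.norm_ofNat]

/-! ### The constant -/

lemma exists_unique_constant : ∃ κ : ℝ, 0 < κ ∧ (4 * κ + 5 * κ ^ 2) * Real.exp (4 * κ) = 1 ∧
    (∀ x : ℝ, 0 < x → (4 * x + 5 * x ^ 2) * Real.exp (4 * x) = 1 → x = κ) ∧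
    |κ - 0.129| < 0.0005 := by
  set f : ℝ → ℝ := fun x => (4 * x + 5 * x ^ 2) * Real.exp (4 * x) with hf
  have hmono : StrictMonoOn f (Set.Ioi 0) := by
    intro x hx y hy hxy
    rw [Set.mem_Ioi] at hx hy
    exact mul_lt_mul'' (by nlinarith) (Real.exp_lt_exp.2 (by linarith)) (by positivity)
      (Real.exp_pos _).le
  have h1 : f 0.1285 < 1 := by
    have h := Real.exp_bound' (x := 4 * 0.1285) (by norm_num) (by norm_num) (n := 5) (by norm_num)
    norm_num [Finset.sum_range_succ, Nat.factorial] at h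
    norm_num [hf]
    linarith
  have h2 : 1 < f 0.1295 := by
    have h := Real.sum_le_exp_of_nonneg (x := 4 * 0.1295) (by norm_num) 5
    norm_num [Finset.sum_range_succ, Nat.factorial] at h
    norm_num [hf]
    linarith
  have hc : ContinuousOn f (Set.Icc 0.1285 0.1295) := by fun_prop
  obtain ⟨κ, hκ, hκ1⟩ := intermediate_value_Ioo (by norm_num) hc ⟨h1, h2⟩
  have hκ0 : 0 < κ := lt_trans (by norm_num) hκ.1
  refine ⟨κ, hκ0, hκ1, fun x hx hx1 => hmono.injOn hx hκ0 (hx1.trans hκ1.symm), ?_⟩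
  rw [abs_lt]
  norm_num at hκ ⊢
  constructor <;> linarith [hκ.1, hκ.2]

end JacobiEnclosure

theorem mainTheorem4 :
    ∃ κ : ℝ, 0 < κ ∧ (4 * κ + 5 * κ ^ 2) * Real.exp (4 * κ) = 1 ∧
      (∀ x : ℝ, 0 < x → (4 * x + 5 * x ^ 2) * Real.exp (4 * x) = 1 → x = κ) ∧
      |κ - 0.129| < 0.0005 ∧
      ∀ J : JacobiEnclosure.JacobiMatrix, J.IsTraceClassPerturbation →
        (∀ z : ℂ, ‖z‖ < 1 →
          ‖JacobiEnclosure.omega z‖ * (Real.sqrt J.Delta + J.Delta) < κ →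
            JacobiEnclosure.perturbationDet z J ≠ 0) ∧
        J.discreteSpectrum ⊆
          {μ : ℂ | μ ∉ Complex.ofReal '' Set.Icc (-2) 2 ∧
            ‖μ ^ 2 - 4‖ ≤ (2 * (Real.sqrt J.Delta + J.Delta) / κ) ^ 2} := by
  obtain ⟨κ, hκ0, hκ1, huniq, hκ⟩ := JacobiEnclosure.exists_unique_constant
  refine ⟨κ, hκ0, hκ1, huniq, hκ, fun J hJ => ?_⟩
  have hκ2 : κ < 1 := by
    have := (abs_lt.1 hκ).2
    norm_num at this
    linarith
  have hD := JacobiEnclosure.delta_nonneg J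
  have hhalf : ∀ z, ‖JacobiEnclosure.omega z‖ * (Real.sqrt J.Delta + J.Delta) < κ →
      J.Delta * (‖JacobiEnclosure.omega z‖ / 2) < 1 / 2 := by
    intro z hz
    have := mul_nonneg (norm_nonneg (JacobiEnclosure.omega z)) (Real.sqrt_nonneg J.Delta)
    linarith
  refine ⟨fun z hz hω h0 => ?_, fun μ hμ => ?_⟩
  · have h := hhalf z hω
    have hle := JacobiEnclosure.norm_perturbationDet_sub_one_le hz hJ (by linarith)
    rw [h0, zero_sub, norm_neg, norm_one, le_div_iff₀ (by linarith)] at hle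
    linarith
  · have hμ2 := JacobiEnclosure.notMem_image_Icc_of_mem_discreteSpectrum hJ hμ
    refine ⟨hμ2, ?_⟩
    obtain ⟨z, hz0, hz, rfl⟩ := JacobiEnclosure.exists_zhukovsky_eq hμ2
    by_contra! hlt
    obtain ⟨u, hu⟩ := hμ.2.1.exists_hasEigenvector
    refine hu.2 (JacobiEnclosure.eq_zero_of_op_eq_smul hz0 hz hJ ?_ hu.apply_eq_smul)
    have hω := JacobiEnclosure.norm_omega_sq_mul hz0 hz
    have hω0 : 0 < ‖JacobiEnclosure.omega z‖ := by
      refine (norm_nonneg _).lt_of_ne fun h => ?_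
      rw [← h] at hω
      norm_num at hω
    refine (hhalf z (lt_of_pow_lt_pow_left₀ 2 hκ0.le ?_)).trans (by norm_num)
    have h1 := mul_lt_mul_of_pos_left hlt (pow_pos hω0 2)
    rw [hω, div_pow, mul_div_assoc', div_lt_iff₀ (pow_pos hκ0 2)] at h1
    nlinarith
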